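/- Let $d \ge 1$. Write $\mathcal{S}_d = \{x \in [0,\infty)^d : x_1 + \cdots + x_d = 1\}$. For $t = (t_1,\ldots,t_d)$ with all $t_i > 0$, let $G_t$ be the law of a row vector with independent coordinates whose $i$-th coordinate has density $x^{t_i-1}e^{-x}/\Gamma(t_i)$ on $(0,\infty)$, and let $D_t$ be the Dirichlet distribution on $\mathcal{S}_d$, with density $\Gamma(t_1+\cdots+t_d)\prod_{i=1}^d x_i^{t_i-1}/\Gamma(t_i)$ with respect to the $(d-1)$-dimensional volume on $\mathcal{S}_d$ (Lebesgue measure in the first $d-1$ coordinates; for $d=1$ the unit mass at the single point of $\mathcal{S}_1$). Let $X$ be a random $d\times d$ stochastic matrix (non-negative entries, all row sums equal to one), let $X(1), X(2), \ldots$ be i.i.d. random matrices with the law of $X$, and put $X(n,1) := X(n)X(n-1)\cdots X(1)$. Let $\mathscr{K}_d$ be the class of laws $\mathcal{L}(X)$ such that $X(n,1)$ converges a.s. as $n\to\infty$ to some random matrix $\widehat X$ whose rows are a.s. identical and are Dirichlet distributed (with some positive parameters). Consider the conditions: [C1] there is a $t\in(0,\infty)^d$ such that, for a random row vector $V\sim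 G_t$ independent of $X$, one has $VX \overset{d}{=} V$; [C2] there is a finite $m \ge 1$ such that, with positive probability, all entries of $X(m,1)$ are positive. (i) $\mathcal{L}(X)\in\mathscr{K}_d$ if and only if both [C1] and [C2] hold. (ii) Suppose that $\mathcal{L}(X)\in\mathscr{K}_d$. Then, for every $t$ as in [C1], each row of the a.s. limit $\widehat X$ has law $D_t$. Moreover, if $Y$ is a random element of $\mathcal{S}_d$ independent of $X$, then $YX\overset{d}{=}Y$ if and only if $Y$ has the same law as the first row of $\widehat X$ (equivalently, as any of its rows); that is, $D_t$ is the unique law on $\mathcal{S}_d$ that is invariant under independent right multiplication by $X$. -/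

import Mathlib

open MeasureTheory ProbabilityTheory Filter Topology
open scoped Matrix

noncomputable section

namespace RandStoch

/-- Real matrices carry the product sigma-algebra (equivalently, the Borel one). -/
instance instMeasurableSpaceMatrix {d : ℕ} : MeasurableSpace (Matrix (Fin d) (Fin d) ℝ) :=
  inferInstanceAs (MeasurableSpace (Fin d → Fin d → ℝ))

/-- The law `Γ_{t₁} ⊗ ⋯ ⊗ Γ_{t_d}` of a vector with independent Gamma coordinates, with shape
parameters `t i` and scale parameter `1`. -/
def gammaVec {d : ℕ} (t : Fin d → ℝ) : Measure (Fin d → ℝ) :=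
  Measure.pi fun i => gammaMeasure (t i) 1

/-- The `(d-1)`-dimensional volume measure on the standard simplex in `ℝ^d`, normalised as usual
for Dirichlet densities: Lebesgue measure in the first `d - 1` coordinates, the last coordinate
being one minus their sum. -/
def simplexVolume : (d : ℕ) → Measure (Fin d → ℝ)
  | 0 => 0
  | n + 1 =>
    ((volume : Measure (Fin n → ℝ)).map
      fun x => (Fin.snoc x (1 - ∑ i, x i) : Fin (n + 1) → ℝ)).restrict
        (stdSimplex ℝ (Fin (n + 1)))

/-- The Dirichlet distribution `D_a` on the standard simplex (for `a` positive), given by its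
density with respect to the volume measure. -/
def dirichlet {d : ℕ} (a : Fin d → ℝ) : Measure (Fin d → ℝ) :=
  (simplexVolume d).withDensity fun x =>
    ENNReal.ofReal (Real.Gamma (∑ i, a i) * ∏ i, (x i ^ (a i - 1) / Real.Gamma (a i)))

/-- Positive stochastic matrices. -/
def positiveStochastic (d : ℕ) : Set (Matrix (Fin d) (Fin d) ℝ) :=
  {A | A ∈ Matrix.rowStochastic ℝ (Fin d) ∧ ∀ i j, 0 < A i j}

/-- The left products: `leftProd x n = x (n-1) * ⋯ * x 1 * x 0`. The sequence is indexed from `0`,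
so that `x k` stands for the matrix usually written `X(k+1)`. -/
def leftProd {d : ℕ} (x : ℕ → Matrix (Fin d) (Fin d) ℝ) : ℕ → Matrix (Fin d) (Fin d) ℝ
  | 0 => 1
  | n + 1 => x n * leftProd x n

/-- `Xs` is an i.i.d. sequence of random matrices with law `μ`, under the probability `P`. -/
structure IsIID {d : ℕ} {Ω : Type*} [MeasurableSpace Ω] (P : Measure Ω)
    (Xs : ℕ → Ω → Matrix (Fin d) (Fin d) ℝ) (μ : Measure (Matrix (Fin d) (Fin d) ℝ)) : Prop where
  measurable : ∀ n, Measurable (Xs n)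
  indep : iIndepFun Xs P
  law : ∀ n, P.map (Xs n) = μ

/-- The left products of the sequence `Xs` converge a.s. to the random matrix `L`, whose rows are
a.s. identical and are Dirichlet distributed. -/
structure HasDirichletLimit {d : ℕ} {Ω : Type*} [MeasurableSpace Ω] (P : Measure Ω)
    (Xs : ℕ → Ω → Matrix (Fin d) (Fin d) ℝ) (L : Ω → Matrix (Fin d) (Fin d) ℝ) : Prop where
  measurable : Measurable L
  tendsto : ∀ᵐ ω ∂P, Tendsto (fun n => leftProd (fun k => Xs k ω) n) atTop (𝓝 (L ω))
  rows_eq : ∀ᵐ ω ∂P, ∀ i j, (L ω).row i = (L ω).row j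
  rows_dirichlet : ∀ i, ∃ a : Fin d → ℝ, (∀ k, 0 < a k) ∧
    P.map (fun ω => (L ω).row i) = dirichlet a

/-- The class `𝒦_d` of laws of random stochastic matrices such that the left products of an
i.i.d. sequence with that law (here the coordinate sequence on the infinite product space)
converge a.s. to a limit with identical, Dirichlet distributed rows. -/
def classK (d : ℕ) : Set (Measure (Matrix (Fin d) (Fin d) ℝ)) :=
  {μ | IsProbabilityMeasure μ ∧ (∀ᵐ A ∂μ, A ∈ Matrix.rowStochastic ℝ (Fin d)) ∧
    ∃ L : (ℕ → Matrix (Fin d) (Fin d) ℝ) → Matrix (Fin d) (Fin d) ℝ,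
      HasDirichletLimit (Measure.infinitePi fun _ : ℕ => μ) (fun n x => x n) L}

/-- For `(V, X)` with law `G_t ⊗ μ`, the random row vector `V X` has the same law as `V`,
where `t` is a positive vector. -/
def GammaInvariant {d : ℕ} (μ : Measure (Matrix (Fin d) (Fin d) ℝ)) (t : Fin d → ℝ) : Prop :=
  (∀ i, 0 < t i) ∧
    ((gammaVec t).prod μ).map (fun p => p.1 ᵥ* p.2) = gammaVec t

/-- Condition [C1]. -/
def CondC1 {d : ℕ} (μ : Measure (Matrix (Fin d) (Fin d) ℝ)) : Prop :=
  ∃ t : Fin d → ℝ, GammaInvariant μ t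

/-- Condition [C2]: some left product of `m ≥ 1` independent matrices with law `μ` is a positive
stochastic matrix with positive probability. -/
def CondC2 {d : ℕ} (μ : Measure (Matrix (Fin d) (Fin d) ℝ)) : Prop :=
  ∃ m : ℕ, 1 ≤ m ∧
    0 < (Measure.infinitePi fun _ : ℕ => μ) {x | leftProd x m ∈ positiveStochastic d}

end RandStoch

end

/-! Gamma and Dirichlet laws determine each other: an independent Gamma variable of shape `∑ i, t i`
times a vector of law `D_t` has law `G_t` (`map_smul_gamma_prod_dirichlet`), and normalising a
vector of law `G_t` gives back `D_t` (`map_normalize_gammaVec`). The map `v ↦ v X` is homogeneous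
and, for stochastic `X`, keeps the coordinate sum. Hence [C1] with parameter `t` says exactly that
`D_t` is invariant under the step `Y ↦ Y X` (`stepLaw_dirichlet`,
`gammaInvariant_of_stepLaw_dirichlet`).

[C2] gives convergence. Left multiplication by a stochastic matrix averages each column, so the gap
between column maximum and minimum never grows, and it shrinks by the factor `1 - ε` when the
multiplier has entries at least `ε`. By independence, blocks of this kind recur forever almost
surely, so the products converge to a matrix with equal rows (`exists_tendsto_leftProd`,
`ae_tendsto_leftProd`).

The limit row carries the only invariant law. It is invariant because the limit is the limit of the
shifted sequence times the independent first factor. If `Y` is invariant, then `Y X(n,1)` has the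
law of `Y` for all `n` and converges to the limit row (`eq_map_row_limitMatrix`). Under [C1] this
law must be `D_t`. Conversely, a Dirichlet limit row is invariant, which is [C1], and almost surely
positive, so the products are eventually positive, which forces [C2]. -/

noncomputable section

namespace RandStoch

/-! ### Column contraction for products of stochastic matrices. -/

section Deterministic

variable {d : ℕ}

lemma leftProd_mem_rowStochastic {x : ℕ → Matrix (Fin d) (Fin d) ℝ}
    (hx : ∀ n, x n ∈ Matrix.rowStochastic ℝ (Fin d)) (n : ℕ) :
    leftProd x n ∈ Matrix.rowStochastic ℝ (Fin d) := by
  induction n with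
  | zero => exact one_mem _
  | succ n ih => exact mul_mem (hx n) ih

/-- Splitting off the rightmost factor, the first in time, leaves a product of the shifted sequence;
this is the form suited to head–tail independence. -/
lemma leftProd_succ' (x : ℕ → Matrix (Fin d) (Fin d) ℝ) (n : ℕ) :
    leftProd x (n + 1) = leftProd (fun k => x (k + 1)) n * x 0 := by
  induction n with
  | zero => simp [leftProd]
  | succ n ih => rw [leftProd, ih, leftProd, Matrix.mul_assoc]

lemma leftProd_add (x : ℕ → Matrix (Fin d) (Fin d) ℝ) (k m : ℕ) :
    leftProd x (k + m) = leftProd (fun i => x (k + i)) m * leftProd x k := by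
  induction m with
  | zero => simp [leftProd]
  | succ m ih => rw [← add_assoc, leftProd, ih, leftProd, Matrix.mul_assoc]

lemma bddAbove_range_fin (v : Fin d → ℝ) : BddAbove (Set.range v) :=
  (Set.finite_range v).bddAbove

lemma bddBelow_range_fin (v : Fin d → ℝ) : BddBelow (Set.range v) :=
  (Set.finite_range v).bddBelow

lemma mul_col (A B : Matrix (Fin d) (Fin d) ℝ) (j : Fin d) :
    (fun i => (A * B) i j) = A *ᵥ fun i => B i j := rfl

variable [NeZero d] {A : Matrix (Fin d) (Fin d) ℝ}

lemma iSup_mulVec_le (hA : A ∈ Matrix.rowStochastic ℝ (Fin d)) (v : Fin d → ℝ) :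
    ⨆ i, (A *ᵥ v) i ≤ ⨆ i, v i := by
  refine ciSup_le fun i => ?_
  calc ∑ j, A i j * v j ≤ ∑ j, A i j * ⨆ k, v k := Finset.sum_le_sum fun j _ =>
        mul_le_mul_of_nonneg_left (le_ciSup (bddAbove_range_fin v) j)
          (Matrix.nonneg_of_mem_rowStochastic hA)
    _ = ⨆ k, v k := by
        rw [← Finset.sum_mul, Matrix.sum_row_of_mem_rowStochastic hA, one_mul]

lemma le_iInf_mulVec (hA : A ∈ Matrix.rowStochastic ℝ (Fin d)) (v : Fin d → ℝ) :
    ⨅ i, v i ≤ ⨅ i, (A *ᵥ v) i := by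
  refine le_ciInf fun i => ?_
  calc ⨅ k, v k = ∑ j, A i j * ⨅ k, v k := by
        rw [← Finset.sum_mul, Matrix.sum_row_of_mem_rowStochastic hA, one_mul]
    _ ≤ ∑ j, A i j * v j := Finset.sum_le_sum fun j _ =>
        mul_le_mul_of_nonneg_left (ciInf_le (bddBelow_range_fin v) j)
          (Matrix.nonneg_of_mem_rowStochastic hA)

/-- Every averaged value gives weight at least `ε` to the minimum of `v`, so the maximum drops by at
least `ε` times the spread, while the minimum does not decrease. -/
lemma spread_mulVec_le (hA : A ∈ Matrix.rowStochastic ℝ (Fin d)) {ε : ℝ}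
    (hε : ∀ i j, ε ≤ A i j) (v : Fin d → ℝ) :
    (⨆ i, (A *ᵥ v) i) - ⨅ i, (A *ᵥ v) i ≤ (1 - ε) * ((⨆ i, v i) - ⨅ i, v i) := by
  obtain ⟨i₀, hi₀⟩ : ∃ i₀, v i₀ = ⨅ i, v i := exists_eq_ciInf_of_finite
  have hlow := le_iInf_mulVec hA v
  have hle : ⨅ k, v k ≤ ⨆ k, v k := hi₀ ▸ le_ciSup (bddAbove_range_fin v) i₀
  have hup : ⨆ i, (A *ᵥ v) i ≤ (⨆ i, v i) - ε * ((⨆ i, v i) - ⨅ i, v i) := by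
    refine ciSup_le fun i => ?_
    have h1 : ε * ((⨆ i, v i) - ⨅ i, v i) ≤ ∑ j, A i j * ((⨆ k, v k) - v j) := by
      calc ε * ((⨆ i, v i) - ⨅ i, v i) ≤ A i i₀ * ((⨆ k, v k) - v i₀) := by
            rw [hi₀]
            exact mul_le_mul_of_nonneg_right (hε i i₀) (sub_nonneg.2 hle)
        _ ≤ _ := Finset.single_le_sum (f := fun j => A i j * ((⨆ k, v k) - v j))
            (fun j _ => mul_nonneg (Matrix.nonneg_of_mem_rowStochastic hA)
              (sub_nonneg.2 (le_ciSup (bddAbove_range_fin v) j))) (Finset.mem_univ i₀)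
    simp only [mul_sub, Finset.sum_sub_distrib, ← Finset.sum_mul,
      Matrix.sum_row_of_mem_rowStochastic hA, one_mul] at h1
    have h2 : (A *ᵥ v) i = ∑ j, A i j * v j := rfl
    rw [h2, mul_sub]
    linarith
  linarith

/-- If infinitely many windows of length `m` have entries bounded below by a fixed `ε > 0`, then
the left products of stochastic matrices converge to a matrix with identical rows. -/
lemma exists_tendsto_leftProd {x : ℕ → Matrix (Fin d) (Fin d) ℝ}
    (hx : ∀ n, x n ∈ Matrix.rowStochastic ℝ (Fin d)) {ε : ℝ} (hε : 0 < ε) (m : ℕ)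
    (hfreq : ∃ᶠ k in atTop, ∀ i j, ε ≤ leftProd (fun l => x (k + l)) m i j) :
    ∃ r : Fin d → ℝ, Tendsto (leftProd x) atTop (𝓝 (Matrix.of fun _ => r)) := by
  have key : ∀ j, ∃ r : ℝ, ∀ i, Tendsto (fun n => leftProd x n i j) atTop (𝓝 r) := by
    intro j
    set M : ℕ → ℝ := fun n => ⨆ i, leftProd x n i j with hM
    set N : ℕ → ℝ := fun n => ⨅ i, leftProd x n i j with hN
    have hMa : Antitone M := antitone_nat_of_succ_le fun n => by
      have := iSup_mulVec_le (hx n) (fun i => leftProd x n i j)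
      rwa [← mul_col] at this
    have hNm : Monotone N := monotone_nat_of_le_succ fun n => by
      have := le_iInf_mulVec (hx n) (fun i => leftProd x n i j)
      rwa [← mul_col] at this
    have hNle : ∀ n i, N n ≤ leftProd x n i j := fun n i =>
      ciInf_le (bddBelow_range_fin fun i => leftProd x n i j) i
    have hleM : ∀ n i, leftProd x n i j ≤ M n := fun n i =>
      le_ciSup (bddAbove_range_fin fun i => leftProd x n i j) i
    have hNM : ∀ n, N n ≤ M n := fun n => (hNle n 0).trans (hleM n 0)
    have hMb : BddBelow (Set.range M) :=
      ⟨N 0, by rintro _ ⟨n, rfl⟩; exact (hNm (Nat.zero_le n)).trans (hNM n)⟩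
    have hNb : BddAbove (Set.range N) :=
      ⟨M 0, by rintro _ ⟨n, rfl⟩; exact (hNM n).trans (hMa (Nat.zero_le n))⟩
    have tM := tendsto_atTop_ciInf hMa hMb
    have tN := tendsto_atTop_ciSup hNm hNb
    set a := ⨅ n, M n
    set b := ⨆ n, N n
    have hstep : ∃ᶠ k in atTop, M (k + m) - N (k + m) - (1 - ε) * (M k - N k) ≤ 0 := by
      refine hfreq.mono fun k hk => ?_
      have := spread_mulVec_le (leftProd_mem_rowStochastic (fun n => hx (k + n)) m) hk
        (fun i => leftProd x k i j)
      rw [← mul_col, ← leftProd_add] at this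
      linarith
    have hlim : Tendsto (fun k => M (k + m) - N (k + m) - (1 - ε) * (M k - N k)) atTop
        (𝓝 (a - b - (1 - ε) * (a - b))) :=
      ((((tendsto_add_atTop_iff_nat m).2 tM).sub ((tendsto_add_atTop_iff_nat m).2 tN))).sub
        ((tM.sub tN).const_mul _)
    -- In the limit the contraction reads `a - b ≤ (1 - ε) * (a - b)`, so `b ≤ a` and `0 < ε` leave
    -- only `a = b`.
    have h1 := le_of_tendsto_of_frequently hlim hstep
    have h2 : b ≤ a := le_of_tendsto_of_tendsto' tN tM hNM
    have hab : a = b := by nlinarith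
    exact ⟨a, fun i => tendsto_of_tendsto_of_tendsto_of_le_of_le (hab ▸ tN) tM
      (fun n => hNle n i) (fun n => hleM n i)⟩
  choose r hr using key
  exact ⟨r, tendsto_pi_nhds.2 fun i => tendsto_pi_nhds.2 fun j => hr j i⟩

end Deterministic

/-! ### Gamma vectors, Dirichlet laws and the passage between them. -/

section GammaDirichlet

lemma lintegral_pi_fin_prod {n : ℕ} (μ : Fin n → Measure ℝ) [∀ i, SigmaFinite (μ i)]
    (f : Fin n → ℝ → ENNReal) (hf : ∀ i, Measurable (f i)) :
    ∫⁻ x, ∏ i, f i (x i) ∂(Measure.pi μ) = ∏ i, ∫⁻ x, f i x ∂(μ i) := by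
  induction n with
  | zero => simp
  | succ n ih =>
    rw [← ((measurePreserving_piFinSuccAbove μ 0).symm).lintegral_comp_emb
      (MeasurableEquiv.measurableEmbedding _)]
    simp only [MeasurableEquiv.piFinSuccAbove_symm_apply, Fin.insertNthEquiv, Equiv.coe_fn_mk,
      Fin.insertNth_zero', Fin.prod_univ_succ, Fin.cons_zero, Fin.cons_succ, Fin.zero_succAbove]
    have hm : Measurable fun x : Fin n → ℝ => ∏ i : Fin n, f i.succ (x i) :=
      Finset.measurable_prod _ fun i _ => (hf i.succ).comp (measurable_pi_apply i)
    rw [← ih _ _ fun i => hf i.succ, ← lintegral_prod_mul (hf 0).aemeasurable hm.aemeasurable]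

lemma pi_withDensity {n : ℕ} (μ : Fin n → Measure ℝ) [∀ i, SigmaFinite (μ i)]
    (f : Fin n → ℝ → ENNReal) (hf : ∀ i, Measurable (f i))
    [∀ i, SigmaFinite ((μ i).withDensity (f i))] :
    Measure.pi (fun i => (μ i).withDensity (f i)) =
      (Measure.pi μ).withDensity fun x => ∏ i, f i (x i) := by
  refine Measure.pi_eq fun s hs => ?_
  rw [withDensity_apply _ (MeasurableSet.univ_pi hs), ← lintegral_indicator
    (MeasurableSet.univ_pi hs)]
  have h : ∀ x : Fin n → ℝ, (Set.univ.pi s).indicator (fun x => ∏ i, f i (x i)) x =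
      ∏ i, (s i).indicator (f i) (x i) := by
    intro x
    by_cases hx : x ∈ Set.univ.pi s
    · rw [Set.indicator_of_mem hx]
      exact Finset.prod_congr rfl fun i _ =>
        (Set.indicator_of_mem (hx i (Set.mem_univ i)) _).symm
    · rw [Set.indicator_of_notMem hx]
      obtain ⟨i, hi⟩ : ∃ i, x i ∉ s i := by simpa [Set.mem_univ_pi] using hx
      exact (Finset.prod_eq_zero (Finset.mem_univ i) (Set.indicator_of_notMem hi _)).symm
  simp_rw [h]
  rw [lintegral_pi_fin_prod μ _ fun i => (hf i).indicator (hs i)]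
  exact Finset.prod_congr rfl fun i _ => by
    rw [lintegral_indicator (hs i), withDensity_apply _ (hs i)]

lemma measurable_gammaPDF (a r : ℝ) : Measurable (gammaPDF a r) :=
  (measurable_gammaPDFReal a r).ennreal_ofReal

instance sigmaFinite_gammaMeasure {d : ℕ} (t : Fin d → ℝ) (i : Fin d) :
    SigmaFinite (gammaMeasure (t i) 1) := by
  unfold gammaMeasure
  exact SigmaFinite.withDensity_ofReal _

lemma gammaVec_eq_withDensity {d : ℕ} (t : Fin d → ℝ) :
    gammaVec t = (volume : Measure (Fin d → ℝ)).withDensity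
      fun v => ∏ i, gammaPDF (t i) 1 (v i) := by
  have (i : Fin d) : SigmaFinite ((volume : Measure ℝ).withDensity (gammaPDF (t i) 1)) :=
    sigmaFinite_gammaMeasure t i
  exact pi_withDensity (fun _ : Fin d => (volume : Measure ℝ)) (fun i => gammaPDF (t i) 1)
    fun i => measurable_gammaPDF _ _

lemma isProbabilityMeasure_gammaVec {d : ℕ} {t : Fin d → ℝ} (ht : ∀ i, 0 < t i) :
    IsProbabilityMeasure (gammaVec t) := by
  have (i : Fin d) : IsProbabilityMeasure (gammaMeasure (t i) 1) :=
    isProbabilityMeasure_gammaMeasure (ht i) one_pos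
  unfold gammaVec
  infer_instance

/-- The parametrisation of the hyperplane `∑ yᵢ = 1` by its first coordinates. -/
def simplexChart {n : ℕ} (x : Fin n → ℝ) : Fin (n + 1) → ℝ :=
  Fin.snoc x (1 - ∑ i, x i)

lemma measurable_snoc {n : ℕ} {β : Type*} [MeasurableSpace β] {f : β → Fin n → ℝ} {g : β → ℝ}
    (hf : Measurable f) (hg : Measurable g) :
    Measurable fun b => (Fin.snoc (f b) (g b) : Fin (n + 1) → ℝ) := by
  refine measurable_pi_iff.2 fun i => ?_
  refine Fin.lastCases ?_ (fun i => ?_) i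
  · simpa using hg
  · simpa [Function.comp_def] using (measurable_pi_apply i).comp hf

lemma measurable_simplexChart {n : ℕ} : Measurable (simplexChart (n := n)) :=
  measurable_snoc measurable_id (by fun_prop)

lemma sum_simplexChart {n : ℕ} (x : Fin n → ℝ) : ∑ i, simplexChart x i = 1 := by
  simp [simplexChart, Fin.sum_univ_castSucc]

lemma lintegral_smul_comp {n : ℕ} {s : ℝ} (hs : s ≠ 0) (g : (Fin n → ℝ) → ENNReal) :
    ∫⁻ w, g w = ENNReal.ofReal |s ^ n| * ∫⁻ x, g (s • x) := by
  have h := Measure.map_addHaar_smul (volume : Measure (Fin n → ℝ)) hs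
  have h2 : ∫⁻ x, g (s • x) = ∫⁻ w, g w ∂(Measure.map (s • ·) (volume : Measure (Fin n → ℝ))) :=
    ((MeasurableEquiv.smul₀ s hs).measurableEmbedding.lintegral_map g).symm
  rw [h2, h, lintegral_smul_measure, smul_eq_mul, ← mul_assoc, ← ENNReal.ofReal_mul (abs_nonneg _),
    ← abs_mul, Module.finrank_fin_fun, mul_inv_cancel₀ (pow_ne_zero _ hs), abs_one,
    ENNReal.ofReal_one, one_mul]

/-- Integration on `ℝⁿ⁺¹` in the coordinates given by the sum of the coordinates and the
normalised vector. -/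
lemma lintegral_eq_lintegral_simplexChart {n : ℕ} {F : (Fin (n + 1) → ℝ) → ENNReal}
    (hF : Measurable F) :
    ∫⁻ v, F v = ∫⁻ s : ℝ, ENNReal.ofReal |s ^ n| * ∫⁻ x, F (s • simplexChart x) := by
  have h1 : ∫⁻ v, F v = ∫⁻ p : ℝ × (Fin n → ℝ), F (Fin.snoc p.2 p.1) := by
    rw [← ((volume_preserving_piFinSuccAbove (fun _ : Fin (n + 1) => ℝ)
      (Fin.last n)).symm).lintegral_comp_emb (MeasurableEquiv.measurableEmbedding _)]
    simp only [MeasurableEquiv.piFinSuccAbove_symm_apply, Fin.insertNthEquiv, Equiv.coe_fn_mk,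
      Fin.insertNth_last']
  have hm : Measurable fun p : ℝ × (Fin n → ℝ) => F (Fin.snoc p.2 p.1) :=
    hF.comp (measurable_snoc measurable_snd measurable_fst)
  rw [h1, Measure.volume_eq_prod, lintegral_prod_symm _ hm.aemeasurable]
  -- A translation makes the total sum `s` the last variable. Once the integrals are swapped, the
  -- substitution `w = s • x` produces the Jacobian `|s ^ n|`.
  have h2 : ∀ w : Fin n → ℝ, ∫⁻ z : ℝ, F (Fin.snoc w z) =
      ∫⁻ s : ℝ, F (Fin.snoc w (s - ∑ i, w i)) := fun w =>
    (lintegral_sub_right_eq_self (fun z => F (Fin.snoc w z)) _).symm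
  simp only [h2]
  rw [lintegral_lintegral_swap]
  · refine lintegral_congr_ae ?_
    have h0 : ∀ᵐ s : ℝ, s ≠ 0 := by simp [ae_iff]
    filter_upwards [h0] with s hs
    rw [lintegral_smul_comp hs]
    congr 2 with x
    congr 1
    ext i
    refine Fin.lastCases ?_ (fun i => ?_) i
    · simp [simplexChart, mul_sub, Finset.mul_sum]
    · simp [simplexChart]
  · exact (hF.comp (measurable_snoc (by fun_prop) (by fun_prop))).aemeasurable

/-- The Dirichlet density. -/
def dirichletPDF {d : ℕ} (a : Fin d → ℝ) (x : Fin d → ℝ) : ENNReal :=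
  ENNReal.ofReal (Real.Gamma (∑ i, a i) * ∏ i, (x i ^ (a i - 1) / Real.Gamma (a i)))

lemma measurable_dirichletPDF {d : ℕ} (a : Fin d → ℝ) : Measurable (dirichletPDF a) := by
  unfold dirichletPDF
  fun_prop

lemma measurableSet_stdSimplex (d : ℕ) : MeasurableSet (stdSimplex ℝ (Fin d)) :=
  (isClosed_stdSimplex ℝ (Fin d)).measurableSet

lemma lintegral_dirichlet {n : ℕ} (a : Fin (n + 1) → ℝ) {F : (Fin (n + 1) → ℝ) → ENNReal}
    (hF : Measurable F) :
    ∫⁻ y, F y ∂(dirichlet a) = ∫⁻ x : Fin n → ℝ,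
      (stdSimplex ℝ (Fin (n + 1))).indicator (fun y => dirichletPDF a y * F y)
        (simplexChart x) := by
  change ∫⁻ y, F y ∂((simplexVolume (n + 1)).withDensity (dirichletPDF a)) = _
  rw [lintegral_withDensity_eq_lintegral_mul _ (measurable_dirichletPDF a) hF]
  change ∫⁻ y, (dirichletPDF a * F) y
    ∂((Measure.map simplexChart volume).restrict (stdSimplex ℝ (Fin (n + 1)))) = _
  rw [← lintegral_indicator (measurableSet_stdSimplex _), lintegral_map _ measurable_simplexChart]
  · rfl
  · exact ((measurable_dirichletPDF a).mul hF).indicator (measurableSet_stdSimplex _)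

/-- The joint Gamma density separates into sum and direction, since the exponentials combine to `exp
(-s)`. For `s < 0`, or `y` off the simplex, some coordinate of `s • y` is negative and both sides
vanish. -/
lemma prod_gammaPDF_smul {n : ℕ} {t : Fin (n + 1) → ℝ} (ht : ∀ i, 0 < t i) {s : ℝ} (hs : s ≠ 0)
    {y : Fin (n + 1) → ℝ} (hy : ∑ i, y i = 1) :
    ENNReal.ofReal |s ^ n| * ∏ i, gammaPDF (t i) 1 ((s • y) i) =
      gammaPDF (∑ i, t i) 1 s *
        (stdSimplex ℝ (Fin (n + 1))).indicator (dirichletPDF t) y := by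
  have hneg : (∃ i, (s • y) i < 0) → ∏ i, gammaPDF (t i) 1 ((s • y) i) = 0 := by
    rintro ⟨i, hi⟩
    exact Finset.prod_eq_zero (Finset.mem_univ i) (gammaPDF_of_neg hi)
  rcases hs.lt_or_gt with hs | hs
  · rw [gammaPDF_of_neg hs, zero_mul, hneg, mul_zero]
    by_contra! h
    have : 0 ≤ ∑ i, (s • y) i := Finset.sum_nonneg fun i _ => h i
    simp only [Pi.smul_apply, smul_eq_mul, ← Finset.mul_sum, hy] at this
    linarith
  by_cases hyS : y ∈ stdSimplex ℝ (Fin (n + 1))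
  swap
  · rw [Set.indicator_of_notMem hyS, mul_zero, hneg, mul_zero]
    by_contra! h
    exact hyS ⟨fun i => nonneg_of_mul_nonneg_right (h i) hs, hy⟩
  rw [Set.indicator_of_mem hyS, gammaPDF_of_nonneg hs.le, dirichletPDF, abs_of_pos (pow_pos hs n)]
  have hT : 0 < ∑ i, t i := Finset.sum_pos (fun i _ => ht i) Finset.univ_nonempty
  have hterm : ∀ i, gammaPDF (t i) 1 ((s • y) i) = ENNReal.ofReal
      (s ^ (t i - 1) * (y i ^ (t i - 1) / Real.Gamma (t i)) * Real.exp (-(s * y i))) := by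
    intro i
    have h0 : 0 ≤ (s • y) i := mul_nonneg hs.le (hyS.1 i)
    rw [gammaPDF_of_nonneg h0]
    congr 1
    simp only [Pi.smul_apply, smul_eq_mul, one_mul, Real.one_rpow]
    rw [Real.mul_rpow hs.le (hyS.1 i)]
    ring
  have hnn : ∀ i, 0 ≤ y i ^ (t i - 1) / Real.Gamma (t i) := fun i =>
    div_nonneg (Real.rpow_nonneg (hyS.1 i) _) (Real.Gamma_pos_of_pos (ht i)).le
  simp only [hterm]
  rw [← ENNReal.ofReal_prod_of_nonneg fun i _ => mul_nonneg (mul_nonneg (Real.rpow_nonneg hs.le _)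
    (hnn i)) (Real.exp_pos _).le, ← ENNReal.ofReal_mul (pow_pos hs n).le, ← ENNReal.ofReal_mul]
  · congr 1
    rw [Finset.prod_mul_distrib, Finset.prod_mul_distrib, ← Real.exp_sum,
      Finset.sum_neg_distrib, ← Finset.mul_sum, hy, ← Real.rpow_sum_of_pos hs,
      Finset.sum_sub_distrib]
    -- The `n + 1` densities lower the exponent of `s` by `n + 1`; the Jacobian restores `n` of it.
    have h1 : s ^ (∑ i, t i - 1) = s ^ n * s ^ (∑ i, t i - ∑ _i : Fin (n + 1), (1 : ℝ)) := by
      rw [← Real.rpow_natCast, ← Real.rpow_add hs]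
      congr 1
      simp only [Finset.sum_const, Finset.card_univ, Fintype.card_fin, nsmul_eq_mul, mul_one]
      push_cast
      ring
    rw [h1]
    have h2 := (Real.Gamma_pos_of_pos hT).ne'
    simp only [Real.one_rpow, one_mul, mul_one]
    field_simp
  · have := Real.Gamma_pos_of_pos hT
    positivity

/-- Lets the Dirichlet measure enter product measures before its total mass is known. -/
instance sFinite_dirichlet {n : ℕ} (a : Fin (n + 1) → ℝ) : SFinite (dirichlet a) := by
  unfold dirichlet simplexVolume
  infer_instance

/-- A Dirichlet vector multiplied by an independent Gamma variable of the right shape has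
independent Gamma coordinates. -/
lemma map_smul_gamma_prod_dirichlet {n : ℕ} {t : Fin (n + 1) → ℝ} (ht : ∀ i, 0 < t i) :
    ((gammaMeasure (∑ i, t i) 1).prod (dirichlet t)).map
      (fun p : ℝ × (Fin (n + 1) → ℝ) => p.1 • p.2) = gammaVec t := by
  have hmeas : Measurable fun p : ℝ × (Fin (n + 1) → ℝ) => p.1 • p.2 := by fun_prop
  refine Measure.ext_of_lintegral _ fun F hF => ?_
  have hpm : Measurable fun v : Fin (n + 1) → ℝ => ∏ i, gammaPDF (t i) 1 (v i) :=
    Finset.measurable_prod _ fun i _ => (measurable_gammaPDF _ _).comp (measurable_pi_apply i)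
  have hFs : ∀ s : ℝ, Measurable fun y : Fin (n + 1) → ℝ => F (s • y) := fun s =>
    hF.comp (measurable_const_smul s)
  rw [lintegral_map hF hmeas, lintegral_prod (fun p : ℝ × (Fin (n + 1) → ℝ) => F (p.1 • p.2))
      (hF.comp hmeas).aemeasurable,
    gammaVec_eq_withDensity, lintegral_withDensity_eq_lintegral_mul _ hpm hF,
    lintegral_eq_lintegral_simplexChart (hpm.mul hF)]
  unfold gammaMeasure
  rw [lintegral_withDensity_eq_lintegral_mul _ (measurable_gammaPDF _ _)
    (Measurable.lintegral_prod_right' (f := fun p : ℝ × (Fin (n + 1) → ℝ) => F (p.1 • p.2))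
      (hF.comp hmeas))]
  refine lintegral_congr_ae ?_
  have h0 : ∀ᵐ s : ℝ, s ≠ 0 := by simp [ae_iff]
  filter_upwards [h0] with s hs
  simp only [Pi.mul_apply]
  rw [lintegral_dirichlet t (hFs s), ← lintegral_const_mul, ← lintegral_const_mul]
  · refine lintegral_congr fun x => ?_
    rw [← mul_assoc, prod_gammaPDF_smul ht hs (sum_simplexChart x), mul_assoc]
    congr 1
    by_cases hx : simplexChart x ∈ stdSimplex ℝ (Fin (n + 1)) <;> simp [hx]
  · exact (hpm.mul hF).comp ((measurable_const_smul s).comp measurable_simplexChart)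
  · exact (((measurable_dirichletPDF t).mul (hFs s)).indicator
      (measurableSet_stdSimplex _)).comp measurable_simplexChart

/-- Comparing total masses in `map_smul_gamma_prod_dirichlet` avoids evaluating a Beta integral. -/
lemma isProbabilityMeasure_dirichlet {n : ℕ} {t : Fin (n + 1) → ℝ} (ht : ∀ i, 0 < t i) :
    IsProbabilityMeasure (dirichlet t) := by
  have h := congrArg (fun m => m Set.univ) (map_smul_gamma_prod_dirichlet ht)
  have := isProbabilityMeasure_gammaVec ht
  have := isProbabilityMeasure_gammaMeasure (a := ∑ i, t i)
    (Finset.sum_pos (fun i _ => ht i) Finset.univ_nonempty) one_pos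
  simp only [Measure.map_apply (show Measurable fun p : ℝ × (Fin (n + 1) → ℝ) => p.1 • p.2 by
    fun_prop) MeasurableSet.univ, Set.preimage_univ, measure_univ] at h
  rw [← Set.univ_prod_univ, Measure.prod_prod, measure_univ, one_mul] at h
  exact ⟨h⟩

lemma ae_gammaMeasure_pos (a : ℝ) : ∀ᵐ x ∂(gammaMeasure a 1), 0 < x := by
  unfold gammaMeasure
  rw [ae_withDensity_iff (measurable_gammaPDF _ _)]
  have h0 : ∀ᵐ s : ℝ, s ≠ 0 := by simp [ae_iff]
  filter_upwards [h0] with s hs h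
  by_contra! h'
  exact h (gammaPDF_of_neg (lt_of_le_of_ne h' hs))

lemma ae_gammaVec_pos {d : ℕ} {t : Fin d → ℝ} (ht : ∀ i, 0 < t i) :
    ∀ᵐ v ∂(gammaVec t), ∀ i, 0 < v i := by
  have (i : Fin d) : IsProbabilityMeasure (gammaMeasure (t i) 1) :=
    isProbabilityMeasure_gammaMeasure (ht i) one_pos
  refine ae_all_iff.2 fun i => ?_
  have h := measurePreserving_eval (fun i => gammaMeasure (t i) 1) i
  exact h.quasiMeasurePreserving.ae (ae_gammaMeasure_pos (t i))

lemma ae_dirichlet_mem_stdSimplex {n : ℕ} (t : Fin (n + 1) → ℝ) :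
    ∀ᵐ y ∂(dirichlet t), y ∈ stdSimplex ℝ (Fin (n + 1)) := by
  have h : dirichlet t ≪ simplexVolume (n + 1) := withDensity_absolutelyContinuous _ _
  exact h.ae_le (ae_restrict_mem (measurableSet_stdSimplex _))

/-- Division of a vector by the sum of its coordinates. -/
def normalize {d : ℕ} (v : Fin d → ℝ) : Fin d → ℝ := (∑ i, v i)⁻¹ • v

lemma measurable_normalize {d : ℕ} : Measurable (normalize (d := d)) := by
  unfold normalize
  fun_prop

lemma map_normalize_gammaVec {n : ℕ} {t : Fin (n + 1) → ℝ} (ht : ∀ i, 0 < t i) :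
    (gammaVec t).map normalize = dirichlet t := by
  have := isProbabilityMeasure_dirichlet ht
  have := isProbabilityMeasure_gammaMeasure (a := ∑ i, t i)
    (Finset.sum_pos (fun i _ => ht i) Finset.univ_nonempty) one_pos
  rw [← map_smul_gamma_prod_dirichlet ht, Measure.map_map measurable_normalize (by fun_prop)]
  -- Normalising `s • y` returns `y`, because `s > 0` and the coordinates of `y` sum to one.
  have h : normalize ∘ (fun p : ℝ × (Fin (n + 1) → ℝ) => p.1 • p.2)
      =ᵐ[(gammaMeasure (∑ i, t i) 1).prod (dirichlet t)] Prod.snd := by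
    filter_upwards [Measure.quasiMeasurePreserving_fst.ae (ae_gammaMeasure_pos _),
      Measure.quasiMeasurePreserving_snd.ae (ae_dirichlet_mem_stdSimplex t)] with p h1 h2
    simp only [Function.comp, normalize, Pi.smul_apply, smul_eq_mul, ← Finset.mul_sum, h2.2,
      mul_one, smul_smul, inv_mul_cancel₀ h1.ne', one_smul]
  rw [Measure.map_congr h, Measure.map_snd_prod, measure_univ, one_smul]

lemma ae_dirichlet_pos {n : ℕ} {t : Fin (n + 1) → ℝ} (ht : ∀ i, 0 < t i) :
    ∀ᵐ y ∂(dirichlet t), ∀ i, 0 < y i := by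
  rw [← map_normalize_gammaVec ht, ae_map_iff measurable_normalize.aemeasurable]
  · filter_upwards [ae_gammaVec_pos ht] with v hv i
    exact mul_pos (inv_pos.2 (Finset.sum_pos (fun i _ => hv i) Finset.univ_nonempty)) (hv i)
  · simp only [Set.ofPred_forall]
    exact MeasurableSet.iInter fun i => measurableSet_lt measurable_const (measurable_pi_apply i)

end GammaDirichlet

/-! ### Independence and stationarity under the shift. -/

section Shift

variable {α : Type*} [MeasurableSpace α]

/-- Under an infinite product of copies of `μ`, the first coordinate and the shifted sequence are
independent, and the shift preserves the product measure. -/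
lemma map_head_tail_infinitePi (μ : Measure α) [IsProbabilityMeasure μ] :
    (Measure.infinitePi fun _ : ℕ => μ).map (fun x => (x 0, fun k => x (k + 1))) =
      μ.prod (Measure.infinitePi fun _ : ℕ => μ) := by
  set Q := Measure.infinitePi fun _ : ℕ => μ
  have hcons : Measurable fun p : α × (ℕ → α) => (fun k => Nat.casesOn k p.1 p.2 : ℕ → α) := by
    refine measurable_pi_iff.2 fun k => ?_
    cases k with
    | zero => exact measurable_fst
    | succ k => exact (measurable_pi_apply k).comp measurable_snd
  -- It suffices to treat the inverse map, which prepends a coordinate; its image law is checked on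
  -- boxes.
  have h : (μ.prod Q).map (fun p => (fun k => Nat.casesOn k p.1 p.2 : ℕ → α)) = Q := by
    refine Measure.eq_infinitePi _ fun s t ht => ?_
    classical
    -- Padding with `Set.univ` makes the box one over an initial segment, where the coordinate `0`
    -- can be split off.
    set T : ℕ → Set α := fun i => if i ∈ s then t i else Set.univ
    have hT : ∀ i, MeasurableSet (T i) := fun i => by
      by_cases hi : i ∈ s <;> simp [T, hi, ht]
    obtain ⟨N, hN⟩ : ∃ N, s ⊆ Finset.range (N + 1) :=
      ⟨s.sup id, fun i hi => Finset.mem_range.2 (Nat.lt_succ_of_le (Finset.le_sup (f := id) hi))⟩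
    have hpre : (fun p : α × (ℕ → α) => (fun k => Nat.casesOn k p.1 p.2 : ℕ → α)) ⁻¹'
        (Set.pi s t) = T 0 ×ˢ Set.pi (Finset.range N) fun i => T (i + 1) := by
      ext ⟨a, x⟩
      simp only [Set.mem_preimage, Set.mem_pi, Finset.mem_coe, Set.mem_prod, Finset.mem_range]
      constructor
      · refine fun h => ⟨?_, fun i _ => ?_⟩
        · by_cases hi : 0 ∈ s
          · simpa [T, hi] using h 0 hi
          · simp [T, hi]
        · by_cases hi : i + 1 ∈ s
          · simpa [T, hi] using h (i + 1) hi
          · simp [T, hi]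
      · rintro ⟨h0, h1⟩ i hi
        cases i with
        | zero => simpa [T, hi] using h0
        | succ i =>
          have := h1 i (by simpa using hN hi)
          simpa [T, hi] using this
    rw [Measure.map_apply hcons (MeasurableSet.pi (Finset.countable_toSet s) fun i _ => ht i),
      hpre, Measure.prod_prod, Measure.infinitePi_pi _ fun i _ => hT (i + 1), mul_comm,
      ← Finset.prod_range_succ' (fun i => μ (T i))]
    rw [← Finset.prod_subset hN fun i _ hi => by simp [T, hi]]
    exact Finset.prod_congr rfl fun i hi => by simp [T, hi]
  conv_lhs => rw [← h]
  rw [Measure.map_map (by fun_prop) hcons]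
  exact Measure.map_id

lemma measurePreserving_shift (μ : Measure α) [IsProbabilityMeasure μ] (k : ℕ) :
    MeasurePreserving (fun (x : ℕ → α) i => x (k + i)) (Measure.infinitePi fun _ : ℕ => μ)
      (Measure.infinitePi fun _ : ℕ => μ) :=
  ⟨by fun_prop, Measure.map_infinitePi_infinitePi_of_inj (P := fun _ : ℕ => μ)
    (add_right_injective k)⟩

end Shift

/-! ### Measurability of matrix operations. -/

section Measurability

variable {d : ℕ}

lemma measurable_entry (i j : Fin d) :
    Measurable fun A : Matrix (Fin d) (Fin d) ℝ => A i j :=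
  (measurable_pi_apply j).comp (measurable_pi_apply i)

lemma measurable_matrix_iff {β : Type*} [MeasurableSpace β] {f : β → Matrix (Fin d) (Fin d) ℝ} :
    Measurable f ↔ ∀ i j, Measurable fun b => f b i j :=
  ⟨fun h i j => (measurable_entry i j).comp h,
    fun h => measurable_pi_iff.2 fun i => measurable_pi_iff.2 fun j => h i j⟩

lemma measurable_matrix_mul {β : Type*} [MeasurableSpace β]
    {f g : β → Matrix (Fin d) (Fin d) ℝ} (hf : Measurable f) (hg : Measurable g) :
    Measurable fun b => f b * g b := by
  refine measurable_matrix_iff.2 fun i j => ?_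
  simp only [Matrix.mul_apply]
  exact Finset.measurable_sum _ fun k _ =>
    (measurable_matrix_iff.1 hf i k).mul (measurable_matrix_iff.1 hg k j)

lemma measurable_vecMul {β : Type*} [MeasurableSpace β] {f : β → Fin d → ℝ}
    {g : β → Matrix (Fin d) (Fin d) ℝ} (hf : Measurable f) (hg : Measurable g) :
    Measurable fun b => f b ᵥ* g b := by
  refine measurable_pi_iff.2 fun j => ?_
  simp only [Matrix.vecMul, dotProduct]
  exact Finset.measurable_sum _ fun k _ =>
    ((measurable_pi_apply k).comp hf).mul (measurable_matrix_iff.1 hg k j)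

lemma measurable_leftProd (n : ℕ) :
    Measurable fun x : ℕ → Matrix (Fin d) (Fin d) ℝ => leftProd x n := by
  induction n with
  | zero => exact measurable_const
  | succ n ih => exact measurable_matrix_mul (measurable_pi_apply n) ih

lemma measurableSet_rowStochastic :
    MeasurableSet {A : Matrix (Fin d) (Fin d) ℝ | A ∈ Matrix.rowStochastic ℝ (Fin d)} := by
  have h : {A : Matrix (Fin d) (Fin d) ℝ | A ∈ Matrix.rowStochastic ℝ (Fin d)} =
      (⋂ i, ⋂ j, {A | 0 ≤ A i j}) ∩ ⋂ i, {A | ∑ j, A i j = 1} := by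
    ext A
    simp [Matrix.mem_rowStochastic_iff_sum]
  rw [h]
  exact (MeasurableSet.iInter fun i => MeasurableSet.iInter fun j =>
      measurableSet_le measurable_const (measurable_entry i j)).inter
    (MeasurableSet.iInter fun i => measurableSet_eq_fun
      (Finset.measurable_sum _ fun j _ => measurable_entry i j) measurable_const)

lemma measurableSet_forall_le_entry (ε : ℝ) :
    MeasurableSet {A : Matrix (Fin d) (Fin d) ℝ | ∀ i j, ε ≤ A i j} := by
  simp only [Set.ofPred_forall]
  exact MeasurableSet.iInter fun i => MeasurableSet.iInter fun j =>
    measurableSet_le measurable_const (measurable_entry i j)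

end Measurability

/-! ### Almost sure convergence under [C2]. -/

section Convergence

variable {d : ℕ} {μ : Measure (Matrix (Fin d) (Fin d) ℝ)}

/-- The law of an i.i.d. sequence. -/
abbrev seqLaw (μ : Measure (Matrix (Fin d) (Fin d) ℝ)) :
    Measure (ℕ → Matrix (Fin d) (Fin d) ℝ) := Measure.infinitePi fun _ : ℕ => μ

/-- Positivity of finitely many entries is the countable union over `n` of the bounds `1 / (n + 1)`,
so one of these events has positive probability. -/
lemma exists_forall_le_entry_of_condC2 (h : CondC2 μ) :
    ∃ m, ∃ ε : ℝ, 0 < ε ∧ 0 < seqLaw μ {x | ∀ i j, ε ≤ leftProd x m i j} := by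
  obtain ⟨m, -, hpos⟩ := h
  refine ⟨m, ?_⟩
  by_contra! hcon
  have hsub : {x : ℕ → Matrix (Fin d) (Fin d) ℝ | leftProd x m ∈ positiveStochastic d} ⊆
      ⋃ n : ℕ, {x | ∀ i j, 1 / ((n : ℝ) + 1) ≤ leftProd x m i j} := by
    intro x hx
    obtain ⟨δ, hδ, hle⟩ : ∃ δ : ℝ, 0 < δ ∧ ∀ p : Fin d × Fin d, δ ≤ leftProd x m p.1 p.2 := by
      rcases isEmpty_or_nonempty (Fin d × Fin d) with he | he
      · exact ⟨1, one_pos, fun p => he.elim p⟩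
      · obtain ⟨p, hp⟩ := Finite.exists_min fun p : Fin d × Fin d => leftProd x m p.1 p.2
        exact ⟨_, hx.2 p.1 p.2, hp⟩
    obtain ⟨n, hn⟩ := exists_nat_one_div_lt hδ
    exact Set.mem_iUnion.2 ⟨n, fun i j => hn.le.trans (hle (i, j))⟩
  refine hpos.ne' (measure_mono_null hsub (measure_iUnion_null fun n => ?_))
  exact le_antisymm (hcon _ (by positivity)) zero_le

variable [IsProbabilityMeasure μ]

lemma ae_seqLaw_rowStochastic (hμ : ∀ᵐ A ∂μ, A ∈ Matrix.rowStochastic ℝ (Fin d)) :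
    ∀ᵐ x ∂(seqLaw μ), ∀ n, x n ∈ Matrix.rowStochastic ℝ (Fin d) :=
  ae_all_iff.2 fun n =>
    (measurePreserving_eval_infinitePi (fun _ : ℕ => μ) n).quasiMeasurePreserving.ae hμ

/-- The product of the first `m` matrices is independent of the remaining sequence. -/
lemma map_leftProd_shift (m : ℕ) :
    (seqLaw μ).map (fun x => (leftProd x m, fun i => x (m + i))) =
      ((seqLaw μ).map fun x => leftProd x m).prod (seqLaw μ) := by
  induction m with
  | zero =>
    simp only [leftProd, zero_add, Measure.map_const, measure_univ, one_smul]
    exact (Measure.dirac_prod _).symm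
  | succ m ih =>
    have hF : Measurable fun x : ℕ → Matrix (Fin d) (Fin d) ℝ =>
        (leftProd x m, fun i => x (m + i)) := (measurable_leftProd m).prodMk (by fun_prop)
    have hH : Measurable fun p : Matrix (Fin d) (Fin d) ℝ ×
        (Matrix (Fin d) (Fin d) ℝ × (ℕ → Matrix (Fin d) (Fin d) ℝ)) => (p.2.1 * p.1, p.2.2) :=
      (measurable_matrix_mul (measurable_fst.comp measurable_snd) measurable_fst).prodMk
        (measurable_snd.comp measurable_snd)
    have hM : Measurable fun p : Matrix (Fin d) (Fin d) ℝ × Matrix (Fin d) (Fin d) ℝ =>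
        p.2 * p.1 := measurable_matrix_mul measurable_snd measurable_fst
    have hht : Measurable fun x : ℕ → Matrix (Fin d) (Fin d) ℝ => (x 0, fun k => x (k + 1)) := by
      fun_prop
    have hhead : MeasurePreserving (fun x : ℕ → Matrix (Fin d) (Fin d) ℝ =>
        (x 0, fun k => x (k + 1))) (seqLaw μ) (μ.prod (seqLaw μ)) :=
      ⟨hht, map_head_tail_infinitePi μ⟩
    -- The head `x 0` is independent of the tail, to which the induction hypothesis applies; it only
    -- multiplies the tail's product of `m` factors on the right.
    have p1 := ((MeasurePreserving.id μ).prod (⟨measurable_leftProd m, rfl⟩ :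
      MeasurePreserving (fun x => leftProd x m) (seqLaw μ) _)).comp hhead
    have p2 := ((MeasurePreserving.id μ).prod (⟨hF, ih⟩ : MeasurePreserving _ _ _)).comp hhead
    have e1 : (seqLaw μ).map (fun x => leftProd x (m + 1)) =
        (μ.prod ((seqLaw μ).map fun x => leftProd x m)).map (fun p => p.2 * p.1) := by
      rw [← p1.map_eq, Measure.map_map hM p1.measurable]
      simp only [leftProd_succ']
      rfl
    have e2 : (seqLaw μ).map (fun x => (leftProd x (m + 1), fun i => x (m + 1 + i))) =
        (μ.prod (((seqLaw μ).map fun x => leftProd x m).prod (seqLaw μ))).map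
          (fun p => (p.2.1 * p.1, p.2.2)) := by
      rw [← p2.map_eq, Measure.map_map hH p2.measurable]
      simp only [leftProd_succ', add_right_comm m 1]
      rfl
    have := Measure.isProbabilityMeasure_map (μ := seqLaw μ) (measurable_leftProd m).aemeasurable
    rw [e2, e1]
    nth_rw 4 [← Measure.map_id (μ := seqLaw μ)]
    rw [Measure.map_prod_map _ _ hM measurable_id, ← Measure.prodAssoc_prod,
      Measure.map_map hH (MeasurableEquiv.measurable _)]
    rfl

/-- If the product of `m` factors has all entries at least `ε` with positive probability, then
almost surely this happens for infinitely many windows. -/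
lemma ae_frequently_forall_le_entry {ε : ℝ} {m : ℕ}
    (hpos : 0 < seqLaw μ {x | ∀ i j, ε ≤ leftProd x m i j}) :
    ∀ᵐ x ∂(seqLaw μ), ∃ᶠ k in atTop, ∀ i j, ε ≤ leftProd (fun l => x (k + l)) m i j := by
  set G : Set (Matrix (Fin d) (Fin d) ℝ) := {A | ∀ i j, ε ≤ A i j}
  have hG : MeasurableSet G := measurableSet_forall_le_entry ε
  set S : ℕ → (ℕ → Matrix (Fin d) (Fin d) ℝ) → (ℕ → Matrix (Fin d) (Fin d) ℝ) :=
    fun k x i => x (k + i) with hS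
  have hSm : ∀ k, Measurable (S k) := fun k => by fun_prop
  -- `B` says that no block starting at a multiple of `m` is good. It forces the first block to be
  -- bad and the shifted sequence to lie in `B` again, so its probability `p` satisfies `p ≤ q * p`
  -- with `q < 1`, and `p = 0`.
  set B : Set (ℕ → Matrix (Fin d) (Fin d) ℝ) := {x | ∀ k, leftProd (S (m * k) x) m ∉ G} with hB
  have hBm : MeasurableSet B := by
    simp only [hB, Set.ofPred_forall]
    exact MeasurableSet.iInter fun k =>
      ((measurable_leftProd m).comp (hSm _)) hG.compl
  have hBsub : B ⊆ (fun x => (leftProd x m, S m x)) ⁻¹' (Gᶜ ×ˢ B) := by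
    intro x hx
    refine ⟨by simpa [hS] using hx 0, fun k => ?_⟩
    have := hx (k + 1)
    simpa only [hS, mul_add, mul_one, ← add_assoc, add_comm (m * k) m] using this
  set lam := (seqLaw μ).map fun x => leftProd x m
  have : IsProbabilityMeasure lam :=
    Measure.isProbabilityMeasure_map (measurable_leftProd m).aemeasurable
  have hle : seqLaw μ B ≤ lam Gᶜ * seqLaw μ B := by
    refine (measure_mono hBsub).trans_eq ?_
    rw [← Measure.map_apply ((measurable_leftProd m).prodMk (hSm m)) (hG.compl.prod hBm),
      map_leftProd_shift, Measure.prod_prod]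
  have hlamG : lam Gᶜ < 1 := by
    have hp : 0 < lam G := by
      rw [Measure.map_apply (measurable_leftProd m) hG]
      exact hpos
    rw [prob_compl_eq_one_sub hG]
    exact ENNReal.sub_lt_self ENNReal.one_ne_top one_ne_zero hp.ne'
  have hB0 : seqLaw μ B = 0 := by
    by_contra h
    have : lam Gᶜ * seqLaw μ B < 1 * seqLaw μ B :=
      ENNReal.mul_lt_mul_left h (measure_ne_top _ _) hlamG
    rw [one_mul] at this
    exact absurd hle (not_le.2 this)
  -- Stationarity yields a good block after every time `N`, hence infinitely many.
  have hall : ∀ᵐ x ∂(seqLaw μ), ∀ N, S N x ∉ B := ae_all_iff.2 fun N =>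
    (measurePreserving_shift μ N).quasiMeasurePreserving.ae (measure_eq_zero_iff_ae_notMem.1 hB0)
  filter_upwards [hall] with x hx
  refine frequently_atTop.2 fun N => ?_
  have := hx N
  simp only [hB, Set.mem_ofPred_eq, not_forall, not_not] at this
  obtain ⟨k, hk⟩ := this
  refine ⟨N + m * k, Nat.le_add_right _ _, ?_⟩
  simp only [hS, ← add_assoc] at hk
  exact hk

/-- The entrywise upper limit of the left products. -/
def limitMatrix (x : ℕ → Matrix (Fin d) (Fin d) ℝ) : Matrix (Fin d) (Fin d) ℝ :=
  Matrix.of fun i j => limsup (fun n => leftProd x n i j) atTop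

/-- The upper limit is defined for every sequence, which gives a measurable version of the almost
sure limit. -/
lemma measurable_limitMatrix : Measurable (limitMatrix (d := d)) :=
  measurable_matrix_iff.2 fun i j =>
    Measurable.limsup fun n => (measurable_entry i j).comp (measurable_leftProd n)

lemma limitMatrix_eq {x : ℕ → Matrix (Fin d) (Fin d) ℝ} {L : Matrix (Fin d) (Fin d) ℝ}
    (h : Tendsto (leftProd x) atTop (𝓝 L)) : limitMatrix x = L := by
  ext i j
  exact (tendsto_pi_nhds.1 (tendsto_pi_nhds.1 h i) j).limsup_eq

/-- Under condition [C2], the left products converge a.s. to a matrix with identical rows. -/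
lemma ae_tendsto_leftProd [NeZero d] (hμ : ∀ᵐ A ∂μ, A ∈ Matrix.rowStochastic ℝ (Fin d))
    (h : CondC2 μ) : ∀ᵐ x ∂(seqLaw μ), Tendsto (leftProd x) atTop (𝓝 (limitMatrix x)) ∧
      ∀ i j, (limitMatrix x).row i = (limitMatrix x).row j := by
  obtain ⟨m, ε, hε, hpos⟩ := exists_forall_le_entry_of_condC2 h
  filter_upwards [ae_seqLaw_rowStochastic hμ, ae_frequently_forall_le_entry hpos] with x h1 h2
  obtain ⟨r, hr⟩ := exists_tendsto_leftProd h1 hε m h2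
  rw [limitMatrix_eq hr]
  exact ⟨hr, fun i j => rfl⟩

end Convergence

/-! ### Invariant laws and the law of the limit row. -/

section Invariance

variable {d : ℕ}

/-- The law of `Y X` for independent `Y ~ ν` and `X ~ μ`. -/
def stepLaw (μ : Measure (Matrix (Fin d) (Fin d) ℝ)) (ν : Measure (Fin d → ℝ)) :
    Measure (Fin d → ℝ) :=
  (ν.prod μ).map fun p => p.1 ᵥ* p.2

lemma measurable_vecMul_prod :
    Measurable fun p : (Fin d → ℝ) × Matrix (Fin d) (Fin d) ℝ => p.1 ᵥ* p.2 :=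
  measurable_vecMul measurable_fst measurable_snd

lemma measurable_row (i : Fin d) : Measurable fun A : Matrix (Fin d) (Fin d) ℝ => A.row i :=
  measurable_pi_apply i

lemma measurable_vecMul_leftProd (n : ℕ) :
    Measurable fun p : (Fin d → ℝ) × (ℕ → Matrix (Fin d) (Fin d) ℝ) => p.1 ᵥ* leftProd p.2 n :=
  measurable_vecMul measurable_fst ((measurable_leftProd n).comp measurable_snd)

lemma sum_vecMul_of_mem_rowStochastic {A : Matrix (Fin d) (Fin d) ℝ}
    (hA : A ∈ Matrix.rowStochastic ℝ (Fin d)) (v : Fin d → ℝ) :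
    ∑ j, (v ᵥ* A) j = ∑ i, v i := by
  simp only [Matrix.vecMul, dotProduct]
  rw [Finset.sum_comm]
  simp [← Finset.mul_sum, Matrix.sum_row_of_mem_rowStochastic hA]

lemma vecMul_eq_row {L : Matrix (Fin d) (Fin d) ℝ} (hL : ∀ i j, L.row i = L.row j)
    {y : Fin d → ℝ} (hy : ∑ i, y i = 1) (i : Fin d) : y ᵥ* L = L.row i := by
  ext j
  have h : ∀ k, L k j = L i j := fun k => congrFun (hL k i) j
  simp [Matrix.vecMul, dotProduct, h, ← Finset.sum_mul, hy, Matrix.row]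

variable {μ : Measure (Matrix (Fin d) (Fin d) ℝ)}

lemma map_row_limitMatrix_comp {Ω : Type*} [MeasurableSpace Ω] {P : Measure Ω}
    {Xs : ℕ → Ω → Matrix (Fin d) (Fin d) ℝ}
    (hXs : MeasurePreserving (fun ω k => Xs k ω) P (seqLaw μ)) (i : Fin d) :
    P.map (fun ω => (limitMatrix fun k => Xs k ω).row i) =
      (seqLaw μ).map fun x => (limitMatrix x).row i := by
  have hR : Measurable fun x : ℕ → Matrix (Fin d) (Fin d) ℝ => (limitMatrix x).row i :=
    (measurable_row i).comp measurable_limitMatrix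
  rw [← hXs.map_eq, Measure.map_map hR hXs.measurable]
  rfl

variable [IsProbabilityMeasure μ]

lemma measurePreserving_head_tail :
    MeasurePreserving (fun x : ℕ → Matrix (Fin d) (Fin d) ℝ => (x 0, fun k => x (k + 1)))
      (seqLaw μ) (μ.prod (seqLaw μ)) :=
  ⟨by fun_prop, map_head_tail_infinitePi μ⟩

/-- By induction the vector times the product of the tail has law `ν` and is independent of `x 0`,
so multiplying by `x 0` is one more invariant step. -/
lemma measurePreserving_vecMul_leftProd {ν : Measure (Fin d → ℝ)} [IsProbabilityMeasure ν]
    (hν : stepLaw μ ν = ν) (n : ℕ) :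
    MeasurePreserving (fun p : (Fin d → ℝ) × (ℕ → Matrix (Fin d) (Fin d) ℝ) =>
      p.1 ᵥ* leftProd p.2 n) (ν.prod (seqLaw μ)) ν := by
  induction n with
  | zero =>
    simp only [leftProd, Matrix.vecMul_one]
    exact measurePreserving_fst
  | succ n ih =>
    have h1 := (MeasurePreserving.id ν).prod
      (Measure.measurePreserving_swap.comp (measurePreserving_head_tail (μ := μ)))
    have h2 := (measurePreserving_prodAssoc ν (seqLaw μ) μ).symm
    have h3 := ih.prod (MeasurePreserving.id μ)
    have h4 : MeasurePreserving (fun p : (Fin d → ℝ) × Matrix (Fin d) (Fin d) ℝ => p.1 ᵥ* p.2)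
      (ν.prod μ) ν := ⟨measurable_vecMul_prod, hν⟩
    have h5 := h4.comp (h3.comp (h2.comp h1))
    simp only [leftProd_succ', ← Matrix.vecMul_vecMul]
    exact h5

/-- The limit of the shifted sequence has the same law as the limit, is independent of `x 0`, and
gives the limit when multiplied by `x 0` on the right. -/
lemma stepLaw_map_row_limitMatrix
    (hconv : ∀ᵐ x ∂(seqLaw μ), Tendsto (leftProd x) atTop (𝓝 (limitMatrix x))) (i : Fin d) :
    stepLaw μ ((seqLaw μ).map fun x => (limitMatrix x).row i) =
      (seqLaw μ).map fun x => (limitMatrix x).row i := by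
  have hR : MeasurePreserving (fun x => (limitMatrix x).row i) (seqLaw μ)
      ((seqLaw μ).map fun x => (limitMatrix x).row i) :=
    ⟨(measurable_row i).comp measurable_limitMatrix, rfl⟩
  have := Measure.isProbabilityMeasure_map (μ := seqLaw μ) hR.measurable.aemeasurable
  have h1 := (hR.prod (MeasurePreserving.id μ)).comp
    (Measure.measurePreserving_swap.comp (measurePreserving_head_tail (μ := μ)))
  rw [stepLaw, ← h1.map_eq, Measure.map_map measurable_vecMul_prod h1.measurable]
  refine Measure.map_congr ?_
  have hs : ∀ᵐ x ∂(seqLaw μ), Tendsto (leftProd fun k => x (1 + k)) atTop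
      (𝓝 (limitMatrix fun k => x (1 + k))) :=
    (measurePreserving_shift μ 1).quasiMeasurePreserving.ae hconv
  filter_upwards [hconv, hs] with x hx hx'
  have e : limitMatrix x = limitMatrix (fun k => x (k + 1)) * x 0 := by
    refine tendsto_nhds_unique ((tendsto_add_atTop_iff_nat 1).2 hx) ?_
    simp only [add_comm 1] at hx'
    simp only [leftProd_succ']
    exact hx'.mul tendsto_const_nhds
  rw [e]
  rfl

/-- Along the products the law stays `ν`, while the vectors converge to the common row because their
coordinates sum to one. Bounded continuous test functions and dominated convergence identify the two
laws. -/
lemma eq_map_row_limitMatrix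
    (hconv : ∀ᵐ x ∂(seqLaw μ), Tendsto (leftProd x) atTop (𝓝 (limitMatrix x)) ∧
      ∀ i j, (limitMatrix x).row i = (limitMatrix x).row j)
    {ν : Measure (Fin d → ℝ)} [IsProbabilityMeasure ν] (hsum : ∀ᵐ y ∂ν, ∑ i, y i = 1)
    (hν : stepLaw μ ν = ν) (i : Fin d) :
    ν = (seqLaw μ).map fun x => (limitMatrix x).row i := by
  have hR : Measurable fun x : ℕ → Matrix (Fin d) (Fin d) ℝ => (limitMatrix x).row i :=
    (measurable_row i).comp measurable_limitMatrix
  have := Measure.isProbabilityMeasure_map (μ := seqLaw μ) hR.aemeasurable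
  refine ext_of_forall_integral_eq_of_IsFiniteMeasure fun f => ?_
  have hconst : ∀ n, ∫ p, f (p.1 ᵥ* leftProd p.2 n) ∂(ν.prod (seqLaw μ)) = ∫ y, f y ∂ν := by
    intro n
    have h := measurePreserving_vecMul_leftProd hν n
    conv_rhs => rw [← h.map_eq]
    rw [integral_map h.measurable.aemeasurable f.continuous.aestronglyMeasurable]
  have hR' : MeasurePreserving (fun p : (Fin d → ℝ) × (ℕ → Matrix (Fin d) (Fin d) ℝ) =>
      (limitMatrix p.2).row i) (ν.prod (seqLaw μ))
      ((seqLaw μ).map fun x => (limitMatrix x).row i) :=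
    MeasurePreserving.comp ⟨hR, rfl⟩ measurePreserving_snd
  have hlim : Tendsto (fun n => ∫ p, f (p.1 ᵥ* leftProd p.2 n) ∂(ν.prod (seqLaw μ))) atTop
      (𝓝 (∫ p, f ((limitMatrix p.2).row i) ∂(ν.prod (seqLaw μ)))) := by
    refine tendsto_integral_of_dominated_convergence (fun _ => ‖f‖) (fun n => ?_)
      (integrable_const _) (fun n => ae_of_all _ fun p => f.norm_coe_le_norm _) ?_
    · exact (f.continuous.measurable.comp (measurable_vecMul_leftProd n)).aestronglyMeasurable
    · filter_upwards [Measure.quasiMeasurePreserving_fst.ae hsum,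
        Measure.quasiMeasurePreserving_snd.ae hconv] with p h1 h2
      rw [← vecMul_eq_row h2.2 h1 i]
      refine (f.continuous.tendsto _).comp ?_
      exact ((Continuous.matrix_vecMul continuous_const continuous_id).tendsto _).comp h2.1
  simp only [hconst] at hlim
  rw [tendsto_nhds_unique tendsto_const_nhds hlim, ← hR'.map_eq,
    integral_map hR'.measurable.aemeasurable f.continuous.aestronglyMeasurable]

end Invariance

/-! ### The conditions [C1] and [C2] and the class `classK`. -/

section Main

variable {n : ℕ} {μ : Measure (Matrix (Fin (n + 1)) (Fin (n + 1)) ℝ)} [IsProbabilityMeasure μ]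
  {t : Fin (n + 1) → ℝ}

/-- Normalisation commutes with right multiplication by a stochastic matrix, since the coordinate
sum is preserved. -/
lemma stepLaw_dirichlet (hμ : ∀ᵐ A ∂μ, A ∈ Matrix.rowStochastic ℝ (Fin (n + 1)))
    (h : GammaInvariant μ t) : stepLaw μ (dirichlet t) = dirichlet t := by
  obtain ⟨ht, h⟩ := h
  have := isProbabilityMeasure_gammaVec ht
  have := isProbabilityMeasure_dirichlet ht
  have hn : MeasurePreserving normalize (gammaVec t) (dirichlet t) :=
    ⟨measurable_normalize, map_normalize_gammaVec ht⟩
  have hp := hn.prod (MeasurePreserving.id μ)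
  rw [stepLaw, ← hp.map_eq, Measure.map_map measurable_vecMul_prod hp.measurable]
  conv_rhs => rw [← map_normalize_gammaVec ht, ← h,
    Measure.map_map measurable_normalize measurable_vecMul_prod]
  refine Measure.map_congr ?_
  filter_upwards [Measure.quasiMeasurePreserving_snd.ae hμ] with p hp
  simp only [Function.comp, Prod.map, id, normalize, sum_vecMul_of_mem_rowStochastic hp,
    Matrix.smul_vecMul]

/-- An independent Gamma scalar commutes with the matrix and turns the Dirichlet vector into a Gamma
vector on both sides. -/
lemma gammaInvariant_of_stepLaw_dirichlet (ht : ∀ i, 0 < t i)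
    (h : stepLaw μ (dirichlet t) = dirichlet t) : GammaInvariant μ t := by
  refine ⟨ht, ?_⟩
  have := isProbabilityMeasure_gammaVec ht
  have := isProbabilityMeasure_dirichlet ht
  have := isProbabilityMeasure_gammaMeasure (a := ∑ i, t i)
    (Finset.sum_pos (fun i _ => ht i) Finset.univ_nonempty) one_pos
  have hg : MeasurePreserving (fun p : ℝ × (Fin (n + 1) → ℝ) => p.1 • p.2)
      ((gammaMeasure (∑ i, t i) 1).prod (dirichlet t)) (gammaVec t) :=
    ⟨by fun_prop, map_smul_gamma_prod_dirichlet ht⟩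
  have h1 := hg.prod (MeasurePreserving.id μ)
  have h2 : MeasurePreserving (fun p : (Fin (n + 1) → ℝ) × Matrix (Fin (n + 1)) (Fin (n + 1)) ℝ =>
      p.1 ᵥ* p.2) ((dirichlet t).prod μ) (dirichlet t) := ⟨measurable_vecMul_prod, h⟩
  have h3 := hg.comp (((MeasurePreserving.id (gammaMeasure (∑ i, t i) 1)).prod h2).comp
    (measurePreserving_prodAssoc (gammaMeasure (∑ i, t i) 1) (dirichlet t) μ))
  rw [← h1.map_eq, Measure.map_map measurable_vecMul_prod h1.measurable]
  conv_rhs => rw [← h3.map_eq]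
  congr 1
  ext p : 1
  simp [MeasurableEquiv.prodAssoc, Matrix.smul_vecMul]

lemma map_row_limitMatrix_eq_dirichlet
    (hμ : ∀ᵐ A ∂μ, A ∈ Matrix.rowStochastic ℝ (Fin (n + 1))) (h2 : CondC2 μ)
    (h : GammaInvariant μ t) (i : Fin (n + 1)) :
    (seqLaw μ).map (fun x => (limitMatrix x).row i) = dirichlet t := by
  have := isProbabilityMeasure_dirichlet h.1
  refine (eq_map_row_limitMatrix (ae_tendsto_leftProd hμ h2) ?_ (stepLaw_dirichlet hμ h) i).symm
  filter_upwards [ae_dirichlet_mem_stdSimplex t] with y hy using hy.2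

lemma hasDirichletLimit {Ω : Type*} [MeasurableSpace Ω] {P : Measure Ω}
    {Xs : ℕ → Ω → Matrix (Fin (n + 1)) (Fin (n + 1)) ℝ}
    (hXs : MeasurePreserving (fun ω k => Xs k ω) P (seqLaw μ))
    (hμ : ∀ᵐ A ∂μ, A ∈ Matrix.rowStochastic ℝ (Fin (n + 1))) (h1 : CondC1 μ) (h2 : CondC2 μ) :
    HasDirichletLimit P Xs fun ω => limitMatrix fun k => Xs k ω where
  measurable := measurable_limitMatrix.comp hXs.measurable
  tendsto := hXs.quasiMeasurePreserving.ae ((ae_tendsto_leftProd hμ h2).mono fun _ h => h.1)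
  rows_eq := hXs.quasiMeasurePreserving.ae ((ae_tendsto_leftProd hμ h2).mono fun _ h => h.2)
  rows_dirichlet i := by
    obtain ⟨t, ht⟩ := h1
    refine ⟨t, ht.1, ?_⟩
    rw [← map_row_limitMatrix_eq_dirichlet hμ h2 ht i, map_row_limitMatrix_comp hXs]

lemma condC1_and_condC2_of_mem_classK (h : μ ∈ classK (n + 1)) : CondC1 μ ∧ CondC2 μ := by
  obtain ⟨-, hμ, L, hL⟩ := h
  have hLeq : L =ᵐ[seqLaw μ] limitMatrix :=
    hL.tendsto.mono fun x hx => (limitMatrix_eq hx).symm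
  constructor
  · obtain ⟨t, ht, hrow⟩ := hL.rows_dirichlet 0
    have hconv : ∀ᵐ x ∂(seqLaw μ), Tendsto (leftProd x) atTop (𝓝 (limitMatrix x)) :=
      hL.tendsto.mono fun x hx => by rw [limitMatrix_eq hx]; exact hx
    have e : (seqLaw μ).map (fun x => (limitMatrix x).row 0) = dirichlet t := by
      rw [← hrow]
      exact Measure.map_congr (hLeq.mono fun x hx => by simp only [hx])
    have := stepLaw_map_row_limitMatrix hconv 0
    rw [e] at this
    exact ⟨t, gammaInvariant_of_stepLaw_dirichlet ht this⟩
  · by_contra hcon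
    have hnot : ∀ m, 1 ≤ m → seqLaw μ {x | leftProd x m ∈ positiveStochastic (n + 1)} = 0 := by
      intro m hm
      by_contra hne
      exact hcon ⟨m, hm, pos_iff_ne_zero.2 hne⟩
    have hae : ∀ᵐ x ∂(seqLaw μ), ∀ m, 1 ≤ m → leftProd x m ∉ positiveStochastic (n + 1) :=
      ae_all_iff.2 fun m => by
        by_cases hm : 1 ≤ m
        · filter_upwards [measure_eq_zero_iff_ae_notMem.1 (hnot m hm)] with x hx _ using hx
        · exact ae_of_all _ fun x h => absurd h hm
    -- Dirichlet vectors are almost surely positive, so convergence of the finitely many entries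
    -- makes some product positive, against the failure of [C2].
    have hpos : ∀ᵐ x ∂(seqLaw μ), ∀ i k, 0 < L x i k := by
      refine ae_all_iff.2 fun i => ?_
      obtain ⟨t, ht, hrow⟩ := hL.rows_dirichlet i
      have := ae_dirichlet_pos ht
      rw [← hrow] at this
      exact ae_of_ae_map ((measurable_row i).comp hL.measurable).aemeasurable this
    have hfalse : ∀ᵐ _ ∂(seqLaw μ), False := by
      filter_upwards [hae, hpos, hL.tendsto, ae_seqLaw_rowStochastic hμ] with x h1 h2 h3 h4
      have hev : ∀ᶠ m in atTop, ∀ i k, 0 < leftProd x m i k :=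
        eventually_all.2 fun i => eventually_all.2 fun k =>
          (tendsto_pi_nhds.1 (tendsto_pi_nhds.1 h3 i) k).eventually_const_lt (h2 i k)
      obtain ⟨m, hm1, hm2⟩ := (hev.and (eventually_ge_atTop 1)).exists
      exact h1 m hm2 ⟨leftProd_mem_rowStochastic h4 m, hm1⟩
    exact hfalse.exists.elim fun _ h => h

end Main

end RandStoch

end

theorem theorem4 {d : ℕ} (hd : 0 < d)
    {Ω : Type*} [MeasurableSpace Ω] (P : Measure Ω) [IsProbabilityMeasure P]
    (X : Ω → Matrix (Fin d) (Fin d) ℝ) (hX : Measurable X)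
    (hXs : ∀ᵐ ω ∂P, X ω ∈ Matrix.rowStochastic ℝ (Fin d)) :
    (P.map X ∈ RandStoch.classK d ↔
      RandStoch.CondC1 (P.map X) ∧ RandStoch.CondC2 (P.map X)) ∧
    (P.map X ∈ RandStoch.classK d →
      ∀ (Ω₁ : Type*) [MeasurableSpace Ω₁] (P₁ : Measure Ω₁) [IsProbabilityMeasure P₁]
        (Xs : ℕ → Ω₁ → Matrix (Fin d) (Fin d) ℝ), RandStoch.IsIID P₁ Xs (P.map X) →
        ∃ L : Ω₁ → Matrix (Fin d) (Fin d) ℝ, RandStoch.HasDirichletLimit P₁ Xs L ∧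
          (∀ t : Fin d → ℝ, RandStoch.GammaInvariant (P.map X) t →
            ∀ i, P₁.map (fun ω => (L ω).row i) = RandStoch.dirichlet t) ∧
          (∀ (Ω₂ : Type*) [MeasurableSpace Ω₂] (P₂ : Measure Ω₂) [IsProbabilityMeasure P₂]
            (X' : Ω₂ → Matrix (Fin d) (Fin d) ℝ) (Y : Ω₂ → Fin d → ℝ),
            Measurable X' → P₂.map X' = P.map X →
            Measurable Y → (∀ᵐ ω ∂P₂, Y ω ∈ stdSimplex ℝ (Fin d)) → IndepFun Y X' P₂ →
            ∀ i, (P₂.map (fun ω => Y ω ᵥ* X' ω) = P₂.map Y ↔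
              P₂.map Y = P₁.map (fun ω => (L ω).row i)))) := by
  obtain ⟨n, rfl⟩ : ∃ n, d = n + 1 := Nat.exists_eq_succ_of_ne_zero hd.ne'
  have hprob : IsProbabilityMeasure (P.map X) := Measure.isProbabilityMeasure_map hX.aemeasurable
  have hμ : ∀ᵐ A ∂(P.map X), A ∈ Matrix.rowStochastic ℝ (Fin (n + 1)) :=
    (ae_map_iff hX.aemeasurable RandStoch.measurableSet_rowStochastic).2 hXs
  refine ⟨⟨RandStoch.condC1_and_condC2_of_mem_classK, fun h => ⟨hprob, hμ, _,
    RandStoch.hasDirichletLimit (MeasurePreserving.id _) hμ h.1 h.2⟩⟩, ?_⟩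
  intro hK Ω₁ _ P₁ _ Xs hIID
  obtain ⟨h1, h2⟩ := RandStoch.condC1_and_condC2_of_mem_classK hK
  -- An i.i.d. sequence has the infinite product law, so all results on sequence space pull back to
  -- `Ω₁`.
  have hXsm : MeasurePreserving (fun ω k => Xs k ω) P₁ (RandStoch.seqLaw (P.map X)) := by
    refine ⟨measurable_pi_iff.2 hIID.measurable, ?_⟩
    rw [(iIndepFun_iff_map_fun_eq_infinitePi_map hIID.measurable).1 hIID.indep]
    simp only [hIID.law]
  have hrow := RandStoch.map_row_limitMatrix_comp hXsm
  refine ⟨_, RandStoch.hasDirichletLimit hXsm hμ h1 h2, fun t ht i => ?_, ?_⟩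
  · rw [hrow, RandStoch.map_row_limitMatrix_eq_dirichlet hμ h2 ht]
  intro Ω₂ _ P₂ _ X' Y hX' hlaw hY hYs hind i
  have hconv := RandStoch.ae_tendsto_leftProd hμ h2
  -- Independence makes the joint law a product, so invariance of `Y` becomes a fixed-point equation
  -- for `stepLaw`.
  have hstep : P₂.map (fun ω => Y ω ᵥ* X' ω) = RandStoch.stepLaw (P.map X) (P₂.map Y) := by
    rw [RandStoch.stepLaw, ← hlaw,
      ← (indepFun_iff_map_prod_eq_prod_map_map hY.aemeasurable hX'.aemeasurable).1 hind,
      Measure.map_map RandStoch.measurable_vecMul_prod (hY.prodMk hX')]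
    rfl
  have hYprob : IsProbabilityMeasure (P₂.map Y) := Measure.isProbabilityMeasure_map hY.aemeasurable
  rw [hstep, hrow]
  constructor
  · intro h
    refine RandStoch.eq_map_row_limitMatrix hconv ?_ h i
    refine (ae_map_iff hY.aemeasurable (measurableSet_eq_fun (by fun_prop) measurable_const)).2 ?_
    filter_upwards [hYs] with ω hω using hω.2
  · intro h
    rw [h]
    exact RandStoch.stepLaw_map_row_limitMatrix (hconv.mono fun _ h => h.1) i
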